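/- Let $\mathbb{H}^2$ be the hyperbolic plane of constant curvature $-1$, let $\mathbb{H}^2\times\mathbb{R}$ carry the Riemannian product metric $\langle\cdot,\cdot\rangle$, and let $\partial_z$ be the unit vertical vector field. A \emph{translating soliton} is an orientable surface $M$ without boundary, smoothly immersed in $\mathbb{H}^2\times\mathbb{R}$, whose mean curvature $H_M$ (the mean of the two principal curvatures, i.e. half the trace of the second fundamental form) with respect to a unit normal field $\eta$ satisfies $H_M(p)=\langle\eta_p,\partial_z\rangle$ at every $p\in M$. \textbf{Theorem.} There does not exist a nonempty properly immersed translating soliton in $\mathbb{H}^2\times\mathbb{R}$ contained in a solid vertical cylinder of bounded radius. That is, if $\psi:M\to\mathbb{H}^2\times\mathbb{R}$ is a proper immersion of a nonempty surface that is a translating soliton, then there are no $c\in\mathbb{H}^2$ and $R\in\mathbb{R}$ such that $\psi(M)\subseteq\{(x,z)\in\mathbb{H}^2\times\mathbb{R} : d_{\mathbb{H}^2}(c,x)\le R\}$. -/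

import Mathlib

open scoped Manifold ContDiff

noncomputable section

namespace HypProd

/-- The Lorentz-Minkowski form `x₁y₁ + x₂y₂ - x₃y₃` on `ℝ³`. -/
def minkowski (x y : EuclideanSpace ℝ (Fin 3)) : ℝ :=
  x 0 * y 0 + x 1 * y 1 - x 2 * y 2

/-- The hyperbolic plane of curvature `-1` (hyperboloid model), with the subspace topology. -/
abbrev HyperbolicPlane : Type :=
  {x : EuclideanSpace ℝ (Fin 3) // minkowski x x = -1 ∧ 0 < x 2}

/-- The hyperbolic distance, `cosh d(x, y) = -⟨x, y⟩`. -/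
def hypDist (x y : HyperbolicPlane) : ℝ :=
  Real.arcosh (-minkowski x.1 y.1)

/-- The flat space `𝕃³ × ℝ`, with coordinates `(x₁, x₂, x₃, z)`, that contains `ℍ² × ℝ`. -/
abbrev Ambient : Type := EuclideanSpace ℝ (Fin 4)

/-- The flat metric `dx₁² + dx₂² - dx₃² + dz²` of `𝕃³ × ℝ`. On vectors tangent to `ℍ² × ℝ` it is
the (positive definite) Riemannian product metric of `ℍ² × ℝ`. -/
def metric (v w : Ambient) : ℝ :=
  v 0 * w 0 + v 1 * w 1 - v 2 * w 2 + v 3 * w 3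

/-- The inclusion of `ℍ² × ℝ` into `𝕃³ × ℝ`. -/
def incl (p : HyperbolicPlane × ℝ) : Ambient :=
  !₂[p.1.1 0, p.1.1 1, p.1.1 2, p.2]

/-- The vector `(x, 0)` at `p = (x, z)`; its orthogonal complement is the tangent space of
`ℍ² × ℝ` at `p`. -/
def radial (p : HyperbolicPlane × ℝ) : Ambient :=
  !₂[p.1.1 0, p.1.1 1, p.1.1 2, 0]

/-- The vertical unit Killing field `∂_z`. -/
def vertical : Ambient := !₂[0, 0, 0, 1]

/-- The solid vertical cylinder of radius `R` around the axis `{c} × ℝ`. -/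
def solidCylinder (c : HyperbolicPlane) (R : ℝ) : Set (HyperbolicPlane × ℝ) :=
  {p | hypDist c p.1 ≤ R}

/-- The model space of surfaces. -/
abbrev Plane : Type := EuclideanSpace ℝ (Fin 2)

section Surface

variable {M : Type*} [TopologicalSpace M] [ChartedSpace Plane M]

/-- `ψ` is a smooth immersion of the surface `M` into `ℍ² × ℝ`. -/
structure IsImmersedSurface (ψ : M → HyperbolicPlane × ℝ) : Prop where
  smooth : ContMDiff 𝓘(ℝ, Plane) 𝓘(ℝ, Ambient) ∞ (fun p => incl (ψ p))
  injective_mfderiv : ∀ p : M,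
    Function.Injective (mfderiv 𝓘(ℝ, Plane) 𝓘(ℝ, Ambient) (fun q => incl (ψ q)) p)

/-- `η` is a (continuous) unit normal vector field along `ψ` in `ℍ² × ℝ`: every `η p` is tangent to
`ℍ² × ℝ`, of unit length and orthogonal to the surface. Such a field exists exactly if the immersed
surface is orientable. -/
structure IsUnitNormal (ψ : M → HyperbolicPlane × ℝ) (η : M → Ambient) : Prop where
  continuous : Continuous η
  tangent : ∀ p, metric (η p) (radial (ψ p)) = 0
  unit : ∀ p, metric (η p) (η p) = 1
  normal : ∀ (p : M) (v : TangentSpace 𝓘(ℝ, Plane) p),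
    metric (η p) (mfderiv 𝓘(ℝ, Plane) 𝓘(ℝ, Ambient) (fun q => incl (ψ q)) p v) = 0

/-- The surface `ψ` read in the chart of `M` at `p`, as a local parametrization. -/
def localParam (ψ : M → HyperbolicPlane × ℝ) (p : M) (y : Plane) : Ambient :=
  incl (ψ ((extChartAt 𝓘(ℝ, Plane) p).symm y))

/-- The first partial derivative `∂ᵢF` of a map `F` of two variables. -/
def partialDeriv (F : Plane → Ambient) (i : Fin 2) (y : Plane) : Ambient :=
  fderiv ℝ F y (EuclideanSpace.single i 1)

/-- The first fundamental form `gᵢⱼ = ⟨∂ᵢF, ∂ⱼF⟩` at `p`, in the chart at `p`. -/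
def firstForm (ψ : M → HyperbolicPlane × ℝ) (p : M) : Matrix (Fin 2) (Fin 2) ℝ :=
  Matrix.of fun i j =>
    metric (partialDeriv (localParam ψ p) i (extChartAt 𝓘(ℝ, Plane) p p))
      (partialDeriv (localParam ψ p) j (extChartAt 𝓘(ℝ, Plane) p p))

/-- The second fundamental form `hᵢⱼ = ⟨∇_{∂ᵢ} ∂ⱼF, η⟩` at `p` with respect to `η`, in the chart at
`p`. Here `∇` is the Levi-Civita connection of `ℍ² × ℝ`; it is the tangential part of the flat
derivative of `𝕃³ × ℝ`, and since `η` is tangent to `ℍ² × ℝ`, the second partial derivatives of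
`F` may be used in its place. -/
def secondForm (ψ : M → HyperbolicPlane × ℝ) (η : M → Ambient) (p : M) :
    Matrix (Fin 2) (Fin 2) ℝ :=
  Matrix.of fun i j =>
    metric (partialDeriv (partialDeriv (localParam ψ p) j) i (extChartAt 𝓘(ℝ, Plane) p p)) (η p)

/-- The mean curvature with respect to `η`: half the trace of the second fundamental form
relative to the first, that is, the mean of the two principal curvatures. -/
def meanCurvature (ψ : M → HyperbolicPlane × ℝ) (η : M → Ambient) (p : M) : ℝ :=
  ((firstForm ψ p)⁻¹ * secondForm ψ η p).trace / 2

/-- The immersed surface `ψ` is a translating soliton: it is orientable and its mean curvature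
equals its angle function, `H = ⟨η, ∂_z⟩`, for a unit normal field `η` (the equation is invariant
under `η ↦ -η`). -/
structure IsTranslatingSoliton (ψ : M → HyperbolicPlane × ℝ) : Prop where
  immersed : IsImmersedSurface ψ
  exists_normal : ∃ η : M → Ambient, IsUnitNormal ψ η ∧
    ∀ p, meanCurvature ψ η p = metric (η p) vertical

end Surface

end HypProd

end

/-!
In a cylinder around `{c} × ℝ` the barrier `cosh d(c, x) - ε √(1 + z²)` attains its maximum on a
properly immersed surface. Since `√` is concave, `cosh d(c, x) - k z² / 2` with `k = ε / √(1 + z²)`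
frozen at the maximum point `p` is maximal there as well. In the flat space `𝕃³ × ℝ` this function
is the quadratic `-⟨c, x⟩ - k z² / 2`, and adding `μ (⟨x, x⟩ + 1) / 2` with the Lagrange multiplier
`μ = cosh d(c, x)` makes its gradient at `p` tangent to `ℍ² × ℝ`, hence equal to `g η` for some `g`.
Tracing the second order condition over the tangent plane gives `cosh d(c, x) - k + 2 g H ≤ 0`. The
vertical component `g ⟨η, ∂_z⟩ = -k z` of the gradient is at most `ε` in absolute value, and so is
`g H` when `|H| ≤ |⟨η, ∂_z⟩|`; as `cosh d(c, x) ≥ 1`, this is impossible for small `ε`.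
-/

noncomputable section

namespace HypProd

open Filter Topology Module

section Calculus

theorem sqrt_sub_sqrt_le {a b : ℝ} (ha : 0 < a) (hb : 0 ≤ b) : √b - √a ≤ (b - a) / (2 * √a) := by
  rw [le_div_iff₀ (mul_pos two_pos (Real.sqrt_pos.2 ha))]
  linarith [Real.sq_sqrt ha.le, Real.sq_sqrt hb, sq_nonneg (√b - √a)]

theorem secondDeriv_nonpos_of_isLocalMax {f f' : ℝ → ℝ} {a b : ℝ} (hmax : IsLocalMax f a)
    (hf : ∀ᶠ t in 𝓝 a, HasDerivAt f (f' t) t) (hf' : HasDerivAt f' b a) : b ≤ 0 := by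
  by_contra! hb
  have hderiv : deriv f =ᶠ[𝓝 a] f' := hf.mono fun t ht => ht.deriv
  have hderiv₂ : deriv (deriv f) a = b := (hderiv.hasDerivAt_iff.2 hf').deriv
  have hmin : IsLocalMin f a := isLocalMin_of_deriv_deriv_pos (by rwa [hderiv₂])
    hmax.deriv_eq_zero hf.self_of_nhds.continuousAt
  have hconst : f =ᶠ[𝓝 a] fun _ => f a := by
    filter_upwards [hmax, hmin] with t ht ht' using le_antisymm ht ht'
  have hzero : deriv (deriv f) a = 0 := by rw [hconst.deriv.deriv_eq]; simp
  exact hb.ne' (hderiv₂.symm.trans hzero)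

variable {X E : Type*} [NormedAddCommGroup X] [NormedSpace ℝ X]
  [NormedAddCommGroup E] [NormedSpace ℝ E]

theorem secondFDeriv_nonpos_of_isLocalMax {f : X → ℝ} {f' : X → X →L[ℝ] ℝ}
    {f'' : X →L[ℝ] X →L[ℝ] ℝ} {x : X} (hmax : IsLocalMax f x)
    (hf : ∀ᶠ y in 𝓝 x, HasFDerivAt f (f' y) y) (hf' : HasFDerivAt f' f'' x) (w : X) :
    f'' w w ≤ 0 := by
  have hline (t : ℝ) : HasDerivAt (fun s : ℝ => x + s • w) w t := by
    simpa using ((hasDerivAt_id t).smul_const w).const_add x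
  have hx : x = x + (0 : ℝ) • w := by simp
  have htendsto : Tendsto (fun t : ℝ => x + t • w) (𝓝 0) (𝓝 x) := by
    simpa using (hline 0).continuousAt.tendsto
  refine secondDeriv_nonpos_of_isLocalMax (f := fun t : ℝ => f (x + t • w))
    (f' := fun t => f' (x + t • w) w) (a := 0) ?_ ?_ ?_
  · simpa [IsLocalMax, IsMaxFilter] using htendsto.eventually hmax
  · filter_upwards [htendsto.eventually hf] with t ht using ht.comp_hasDerivAt t (hline t)
  · exact ((ContinuousLinearMap.apply ℝ ℝ w).hasFDerivAt.comp x hf').comp_hasDerivAt_of_eq 0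
      (hline 0) hx

theorem secondOrder_of_isLocalMax_comp {f : E → ℝ} {f' : E → E →L[ℝ] ℝ} {f'' : E →L[ℝ] E →L[ℝ] ℝ}
    {F : X → E} {x : X} (hF : ContDiffAt ℝ 2 F x) (hmax : IsLocalMax (f ∘ F) x)
    (hf : ∀ v, HasFDerivAt f (f' v) v) (hf' : HasFDerivAt f' f'' (F x)) (w : X) :
    f' (F x) (fderiv ℝ F x w) = 0 ∧
      f'' (fderiv ℝ F x w) (fderiv ℝ F x w) + f' (F x) (fderiv ℝ (fderiv ℝ F) x w w) ≤ 0 := by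
  have hFx : HasFDerivAt F (fderiv ℝ F x) x := (hF.differentiableAt (by simp)).hasFDerivAt
  have hF' : HasFDerivAt (fderiv ℝ F) (fderiv ℝ (fderiv ℝ F) x) x :=
    ((hF.fderiv_right (m := 1) (by norm_num)).differentiableAt (by simp)).hasFDerivAt
  have hcomp : ∀ᶠ y in 𝓝 x, HasFDerivAt (f ∘ F) ((f' (F y)).comp (fderiv ℝ F y)) y := by
    filter_upwards [hF.eventually (by simp)] with y hy
    exact (hf _).comp y (hy.differentiableAt (by simp)).hasFDerivAt
  have hfirst := hmax.hasFDerivAt_eq_zero hcomp.self_of_nhds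
  have hsecond := secondFDeriv_nonpos_of_isLocalMax hmax hcomp
    ((hf'.comp x hFx).clm_comp hF') w
  refine ⟨by simpa using DFunLike.congr_fun hfirst w, ?_⟩
  simpa [add_comm] using hsecond

theorem hasFDerivAt_half_quadratic_sub (β : E →L[ℝ] E →L[ℝ] ℝ) (hβ : ∀ u v, β u v = β v u)
    (ℓ : E →L[ℝ] ℝ) (v : E) : HasFDerivAt (fun u => β u u / 2 - ℓ u) (β v - ℓ) v := by
  have hquad : HasFDerivAt (fun u => β u u) (2 • β v) v :=
    (β.hasFDerivAt_of_bilinear (hasFDerivAt_id v) (hasFDerivAt_id v)).congr_fderiv <| by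
      ext u
      simp [hβ u v, two_mul]
  have hhalf := (hquad.const_mul (1 / 2 : ℝ)).fun_sub ℓ.hasFDerivAt
  refine (hhalf.congr_fderiv ?_).congr_of_eventuallyEq (.of_forall fun u => ?_)
  · ext u
    simp
  · ring

theorem secondOrder_of_isLocalMax_quadratic_comp {β : E →L[ℝ] E →L[ℝ] ℝ} (hβ : ∀ u v, β u v = β v u)
    {ℓ : E →L[ℝ] ℝ} {F : X → E} {x : X} (hF : ContDiffAt ℝ 2 F x)
    (hmax : IsLocalMax (fun y => β (F y) (F y) / 2 - ℓ (F y)) x) (w : X) :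
    (β (F x) - ℓ) (fderiv ℝ F x w) = 0 ∧
      β (fderiv ℝ F x w) (fderiv ℝ F x w) +
        (β (F x) - ℓ) (fderiv ℝ (fderiv ℝ F) x w w) ≤ 0 :=
  secondOrder_of_isLocalMax_comp (f := fun u => β u u / 2 - ℓ u) hF hmax
    (hasFDerivAt_half_quadratic_sub β hβ ℓ) (β.hasFDerivAt.sub_const ℓ) w

end Calculus

section LinearAlgebra

open Matrix

theorem exists_orthonormal_trace_inv_toMatrix_mul {ι V : Type*} [Fintype ι] [DecidableEq ι]
    [AddCommGroup V] [Module ℝ V] (b : Basis ι ℝ V) {β : LinearMap.BilinForm ℝ V}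
    (hsymm : β.IsSymm) (hpos : ∀ v ≠ 0, 0 < β v v) :
    ∃ w : ι → V, (∀ i j, β (w i) (w j) = if i = j then 1 else 0) ∧
      ∀ γ : LinearMap.BilinForm ℝ V,
        ((β.toMatrix b)⁻¹ * γ.toMatrix b).trace = ∑ i, γ (w i) (w i) := by
  have hposDef : (β.toMatrix b).PosDef :=
    (LinearMap.BilinForm.posDef_toQuadraticMap_iff_matrix b β hsymm).1 hpos
  obtain ⟨A, hA, hβ⟩ : ∃ A : Matrix ι ι ℝ, IsUnit A ∧ β.toMatrix b = Aᵀ * A := by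
    open scoped MatrixOrder Matrix.Norms.L2Operator in
    exact CStarAlgebra.isStrictlyPositive_iff_eq_star_mul_self.1 hposDef.isStrictlyPositive
  have hdet : IsUnit A.det := (isUnit_iff_isUnit_det A).1 hA
  set w : ι → V := fun j => b.equivFun.symm (A⁻¹.col j) with hw
  have hform (γ : LinearMap.BilinForm ℝ V) (i j : ι) :
      γ (w i) (w j) = (A⁻¹ᵀ * γ.toMatrix b * A⁻¹) i j := by
    rw [hw, ← LinearMap.BilinForm.dotProduct_toMatrix_mulVec]
    exact (mul_mul_apply _ _ _ i j).symm
  refine ⟨w, fun i j => ?_, fun γ => ?_⟩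
  · rw [hform, hβ, transpose_nonsing_inv, ← mul_assoc,
      nonsing_inv_mul _ (by rwa [det_transpose]), one_mul, mul_nonsing_inv _ hdet, one_apply]
  · calc ((β.toMatrix b)⁻¹ * γ.toMatrix b).trace
        = (A⁻¹ * (A⁻¹ᵀ * γ.toMatrix b)).trace := by
          rw [hβ, Matrix.mul_inv_rev, transpose_nonsing_inv, mul_assoc]
      _ = (A⁻¹ᵀ * γ.toMatrix b * A⁻¹).trace := trace_mul_comm _ _
      _ = ∑ i, γ (w i) (w i) := by simp only [trace, diag_apply, hform]

theorem eq_zero_of_forall_eq_zero_of_isOrthoᵢ {K V ι : Type*} [Field K] [AddCommGroup V]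
    [Module K V] [FiniteDimensional K V] [Fintype ι] {B : LinearMap.BilinForm K V} {e : ι → V}
    (hcard : Fintype.card ι = finrank K V) (hortho : B.IsOrthoᵢ e)
    (hne : ∀ i, B (e i) (e i) ≠ 0) {v : V} (hv : ∀ i, B v (e i) = 0) : B v = 0 := by
  have hspan : Submodule.span K (Set.range e) = ⊤ :=
    (LinearMap.linearIndependent_of_isOrthoᵢ hortho hne).span_eq_top_of_card_eq_finrank' hcard
  exact LinearMap.ext_on_range hspan hv

end LinearAlgebra

section Hyperboloid

/-- Expanding `0 ≤ ∑ i < 2, (x₂ cᵢ - c₂ xᵢ)²`. -/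
theorem sq_add_sq_le_neg_minkowski (c x : HyperbolicPlane) :
    c.1 2 ^ 2 + x.1 2 ^ 2 ≤ 2 * (c.1 2 * x.1 2) * -minkowski c.1 x.1 := by
  have hc := c.2.1
  have hx := x.2.1
  simp only [minkowski] at hc hx ⊢
  linear_combination sq_nonneg (x.1 2 * c.1 0 - c.1 2 * x.1 0) +
    sq_nonneg (x.1 2 * c.1 1 - c.1 2 * x.1 1) + x.1 2 ^ 2 * hc + c.1 2 ^ 2 * hx

theorem one_le_neg_minkowski (c x : HyperbolicPlane) : 1 ≤ -minkowski c.1 x.1 := by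
  have hpos : 0 < 2 * (c.1 2 * x.1 2) := mul_pos two_pos (mul_pos c.2.2 x.2.2)
  refine le_of_mul_le_mul_left ?_ hpos
  linarith [sq_add_sq_le_neg_minkowski c x, two_mul_le_add_sq (c.1 2) (x.1 2)]

theorem apply_two_le_neg_minkowski (c x : HyperbolicPlane) :
    x.1 2 ≤ 2 * c.1 2 * -minkowski c.1 x.1 := by
  refine le_of_mul_le_mul_left ?_ x.2.2
  linarith [sq_add_sq_le_neg_minkowski c x, sq_nonneg (c.1 2)]

theorem neg_minkowski_le_cosh {c x : HyperbolicPlane} {R : ℝ} (h : hypDist c x ≤ R) :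
    -minkowski c.1 x.1 ≤ Real.cosh R := by
  have hone := one_le_neg_minkowski c x
  rw [← Real.cosh_arcosh hone, Real.cosh_le_cosh, abs_of_nonneg (Real.arcosh_nonneg hone)]
  exact h.trans (le_abs_self R)

theorem continuous_minkowski (c : EuclideanSpace ℝ (Fin 3)) : Continuous (minkowski c) := by
  unfold minkowski
  fun_prop

theorem isClosed_hyperbolicPlane :
    IsClosed {x : EuclideanSpace ℝ (Fin 3) | minkowski x x = -1 ∧ 0 < x 2} := by
  have hset : {x : EuclideanSpace ℝ (Fin 3) | minkowski x x = -1 ∧ 0 < x 2} =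
      {x | minkowski x x = -1} ∩ {x | 0 ≤ x 2} := by
    ext x
    refine and_congr_right fun hx => ⟨le_of_lt, fun hle => hle.lt_of_ne' fun hzero => ?_⟩
    rw [minkowski, hzero] at hx
    linarith [mul_self_nonneg (x 0), mul_self_nonneg (x 1)]
  rw [hset]
  refine IsClosed.inter (isClosed_eq ?_ continuous_const) (isClosed_le continuous_const ?_)
  · unfold minkowski
    fun_prop
  · fun_prop

theorem isCompact_setOf_neg_minkowski_le (c : HyperbolicPlane) (B : ℝ) :
    IsCompact {x : HyperbolicPlane | -minkowski c.1 x.1 ≤ B} := by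
  have hbounded : {x : HyperbolicPlane | -minkowski c.1 x.1 ≤ B} ⊆
      Subtype.val ⁻¹' Metric.closedBall 0 √(2 * (2 * c.1 2 * B) ^ 2) := by
    intro x (hx : -minkowski c.1 x.1 ≤ B)
    have hheight : x.1 2 ≤ 2 * c.1 2 * B := (apply_two_le_neg_minkowski c x).trans
      (mul_le_mul_of_nonneg_left hx (mul_pos two_pos c.2.2).le)
    have hsq : x.1 2 ^ 2 ≤ (2 * c.1 2 * B) ^ 2 := pow_le_pow_left₀ x.2.2.le hheight 2
    have hquad := x.2.1
    rw [minkowski] at hquad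
    simp only [Set.mem_preimage, mem_closedBall_zero_iff, EuclideanSpace.norm_eq,
      Fin.sum_univ_three, Real.norm_eq_abs, sq_abs]
    exact Real.sqrt_le_sqrt (by linarith)
  have hclosed : IsClosed {x : HyperbolicPlane | -minkowski c.1 x.1 ≤ B} :=
    isClosed_le ((continuous_minkowski c.1).comp continuous_subtype_val).neg continuous_const
  exact (isClosed_hyperbolicPlane.isClosedEmbedding_subtypeVal.isCompact_preimage
    (isCompact_closedBall _ _)).of_isClosed_subset hclosed hbounded

end Hyperboloid

section AmbientMetric

/-- `metric` as a continuous bilinear map. -/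
def metricCLM : Ambient →L[ℝ] Ambient →L[ℝ] ℝ :=
  (LinearMap.mk₂ ℝ metric
    (fun u v w => by simp only [metric, PiLp.add_apply]; ring)
    (fun a v w => by simp only [metric, PiLp.smul_apply, smul_eq_mul]; ring)
    (fun u v w => by simp only [metric, PiLp.add_apply]; ring)
    (fun a v w => by simp only [metric, PiLp.smul_apply, smul_eq_mul]; ring)
    ).toContinuousBilinearMap

theorem metricCLM_apply (v w : Ambient) : metricCLM v w = metric v w := rfl

theorem metric_comm (v w : Ambient) : metric v w = metric w v := by
  simp only [metric, mul_comm]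

theorem metric_sub_left (u v w : Ambient) : metric (u - v) w = metric u w - metric v w := by
  simp only [← metricCLM_apply, map_sub, sub_apply]

theorem metric_smul_left (a : ℝ) (v w : Ambient) : metric (a • v) w = a * metric v w := by
  simp only [← metricCLM_apply, map_smul, smul_apply, smul_eq_mul]

theorem metric_sub_right (u v w : Ambient) : metric u (v - w) = metric u v - metric u w := by
  simp only [← metricCLM_apply, map_sub]

theorem metric_vertical (v : Ambient) : metric v vertical = v 3 := by
  simp [metric, vertical]

theorem metric_radial_incl (p q : HyperbolicPlane × ℝ) :
    metric (radial p) (incl q) = minkowski p.1.1 q.1.1 := by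
  simp [metric, radial, incl, minkowski]

theorem metric_radial_radial (p q : HyperbolicPlane × ℝ) :
    metric (radial p) (radial q) = minkowski p.1.1 q.1.1 := by
  simp [metric, radial, minkowski]

theorem metric_incl_self (p : HyperbolicPlane × ℝ) : metric (incl p) (incl p) = p.2 ^ 2 - 1 := by
  have hp := p.1.2.1
  simp only [minkowski] at hp
  simp only [metric, incl, Matrix.cons_val_zero, Matrix.cons_val_one, Matrix.cons_val]
  linear_combination hp

/-- Lagrange's identity, with `v 2` eliminated through `⟨v, radial p⟩ = 0`. -/
theorem sq_mul_metric_self {p : HyperbolicPlane × ℝ} {v : Ambient}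
    (hv : metric v (radial p) = 0) :
    p.1.1 2 ^ 2 * metric v v =
      v 0 ^ 2 + v 1 ^ 2 + (v 0 * p.1.1 1 - v 1 * p.1.1 0) ^ 2 + p.1.1 2 ^ 2 * v 3 ^ 2 := by
  have hp := p.1.2.1
  simp only [metric, radial, Matrix.cons_val_zero, Matrix.cons_val_one, Matrix.cons_val,
    mul_zero, add_zero] at hv
  simp only [metric, minkowski] at hp ⊢
  linear_combination (v 2 * p.1.1 2 + v 0 * p.1.1 0 + v 1 * p.1.1 1) * hv -
    (v 0 ^ 2 + v 1 ^ 2) * hp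

theorem metric_self_nonneg {p : HyperbolicPlane × ℝ} {v : Ambient}
    (hv : metric v (radial p) = 0) : 0 ≤ metric v v := by
  have hpos : 0 < p.1.1 2 ^ 2 := pow_pos p.1.2.2 2
  refine nonneg_of_mul_nonneg_right ?_ hpos
  rw [sq_mul_metric_self hv]
  positivity

theorem metric_self_pos {p : HyperbolicPlane × ℝ} {v : Ambient}
    (hv : metric v (radial p) = 0) (hne : v ≠ 0) : 0 < metric v v := by
  refine (metric_self_nonneg hv).lt_of_ne' fun hzero => hne ?_
  have hheight : p.1.1 2 ≠ 0 := p.1.2.2.ne'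
  have hsum := sq_mul_metric_self hv
  rw [hzero, mul_zero, ← mul_pow] at hsum
  have hcross := sq_nonneg (v 0 * p.1.1 1 - v 1 * p.1.1 0)
  have hsq₀ := sq_nonneg (v 0)
  have hsq₁ := sq_nonneg (v 1)
  have hsq₃ := sq_nonneg (p.1.1 2 * v 3)
  have hv₀ : v 0 = 0 := sq_eq_zero_iff.1 (by linarith)
  have hv₁ : v 1 = 0 := sq_eq_zero_iff.1 (by linarith)
  have hv₃ : v 3 = 0 := (mul_eq_zero_iff_left hheight).1 (sq_eq_zero_iff.1 (by linarith))
  have hv₂ : v 2 = 0 := by simpa [metric, radial, hv₀, hv₁, hheight] using hv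
  ext i
  fin_cases i <;> assumption

end AmbientMetric

section Frames

variable {p : HyperbolicPlane × ℝ}

theorem sum_sq_metric_le {ι : Type*} [Fintype ι] [DecidableEq ι] {e : ι → Ambient}
    (he : ∀ i j, metric (e i) (e j) = if i = j then 1 else 0)
    (htangent : ∀ i, metric (e i) (radial p) = 0) {v : Ambient} (hv : metric v (radial p) = 0) :
    ∑ i, metric v (e i) ^ 2 ≤ metric v v := by
  set s : Ambient := ∑ i, metric v (e i) • e i with hs
  have hmetric_s (u : Ambient) : metric s u = ∑ i, metric v (e i) * metric (e i) u := by
    simp only [hs, ← metricCLM_apply, map_sum, map_smul, sum_apply, smul_apply, smul_eq_mul]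
  have hsv : metric s v = ∑ i, metric v (e i) ^ 2 := by
    simp only [hmetric_s, metric_comm (e _) v, sq]
  have hse (i : ι) : metric s (e i) = metric v (e i) := by
    simp only [hmetric_s, he, mul_ite, mul_one, mul_zero, Finset.sum_ite_eq', Finset.mem_univ,
      if_true]
  have hss : metric s s = metric s v := by
    rw [hmetric_s s, hsv]
    exact Finset.sum_congr rfl fun i _ => by rw [metric_comm (e i) s, hse, sq]
  have hresidual : metric (v - s) (radial p) = 0 := by
    simp only [metric_sub_left, hmetric_s, htangent, hv, mul_zero, Finset.sum_const_zero, sub_zero]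
  have hnonneg := metric_self_nonneg hresidual
  rw [metric_sub_left, metric_sub_right, metric_sub_right, hss, metric_comm v s, hsv] at hnonneg
  linarith

theorem eq_metric_smul_normal {e : Fin 2 → Ambient} {n v : Ambient}
    (he : ∀ i j, metric (e i) (e j) = if i = j then 1 else 0)
    (htangent : ∀ i, metric (e i) (radial p) = 0) (hn : metric n n = 1)
    (hn_tangent : metric n (radial p) = 0) (hn_normal : ∀ i, metric n (e i) = 0)
    (hv : metric v (radial p) = 0) (hv_normal : ∀ i, metric v (e i) = 0) :
    v = metric v n • n := by
  set u : Ambient := v - metric v n • n with hu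
  have hu_metric (x : Ambient) : metric u x = metric v x - metric v n * metric n x := by
    rw [hu, metric_sub_left, metric_smul_left]
  have hu_tangent : metric u (radial p) = 0 := by rw [hu_metric, hv, hn_tangent]; ring
  have hradial : metric (radial p) (radial p) = -1 := by rw [metric_radial_radial, p.1.2.1]
  have hzero : metricCLM.toBilinForm u = 0 := by
    refine eq_zero_of_forall_eq_zero_of_isOrthoᵢ (e := ![e 0, e 1, n, radial p]) (by simp)
      ?_ ?_ ?_
    · intro i j hij
      fin_cases i <;> fin_cases j <;>
        simp_all [Function.onFun, metricCLM_apply, metric_comm (e _) n,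
          metric_comm (radial p)]
    · intro i
      fin_cases i <;> simp [metricCLM_apply, he, hn, hradial]
    · intro i
      fin_cases i <;> simp [metricCLM_apply, hu_metric, hv, hv_normal, hn, hn_tangent, hn_normal]
  by_contra hne
  exact (metric_self_pos hu_tangent (sub_ne_zero.2 hne)).ne' (DFunLike.congr_fun hzero u)

end Frames

section Barrier

/-- The barrier `cosh d(c, x) - ε √(1 + z²)` on `ℍ² × ℝ`. -/
def barrier (c : HyperbolicPlane) (ε : ℝ) (p : HyperbolicPlane × ℝ) : ℝ :=
  -minkowski c.1 p.1.1 - ε * √(1 + p.2 ^ 2)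

theorem continuous_barrier (c : HyperbolicPlane) (ε : ℝ) : Continuous (barrier c ε) := by
  have hminkowski := continuous_minkowski c.1
  unfold barrier
  fun_prop

theorem exists_forall_barrier_le {M : Type*} [TopologicalSpace M] [Nonempty M]
    {ψ : M → HyperbolicPlane × ℝ} (hproper : IsProperMap ψ) {c : HyperbolicPlane} {R : ℝ}
    (hcylinder : Set.range ψ ⊆ solidCylinder c R) {ε : ℝ} (hε : 0 < ε) :
    ∃ p, ∀ q, barrier c ε (ψ q) ≤ barrier c ε (ψ p) := by
  obtain ⟨p₀⟩ := ‹Nonempty M›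
  set C : ℝ := (Real.cosh R - barrier c ε (ψ p₀)) / ε
  have hcosh (q : M) : -minkowski c.1 (ψ q).1.1 ≤ Real.cosh R :=
    neg_minkowski_le_cosh (hcylinder ⟨q, rfl⟩)
  have hheight (q : M) (hq : barrier c ε (ψ p₀) < barrier c ε (ψ q)) : |(ψ q).2| ≤ C := by
    have habs : |(ψ q).2| ≤ √(1 + (ψ q).2 ^ 2) := Real.abs_le_sqrt (by linarith)
    refine habs.trans ((le_div_iff₀ hε).2 ?_)
    linarith [hcosh q, show barrier c ε (ψ q) =
      -minkowski c.1 (ψ q).1.1 - ε * √(1 + (ψ q).2 ^ 2) from rfl]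
  have hcompact : IsCompact ({x : HyperbolicPlane | -minkowski c.1 x.1 ≤ Real.cosh R} ×ˢ
      Set.Icc (-C) C) := (isCompact_setOf_neg_minkowski_le c _).prod isCompact_Icc
  refine ((continuous_barrier c ε).comp hproper.continuous).exists_forall_ge' p₀ ?_
  filter_upwards [(hproper.isCompact_preimage hcompact).compl_mem_cocompact] with q hq
  by_contra! hlt
  exact hq ⟨hcosh q, abs_le.1 (hheight q hlt)⟩

/-- The form `μ (dx₁² + dx₂² - dx₃²) - k dz²`. On `ℍ² × ℝ` its square is `-μ - k z²`, so that `μ`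
plays the role of a Lagrange multiplier for the constraint `⟨x, x⟩ = -1`. -/
def comparisonForm (μ k : ℝ) : Ambient →L[ℝ] Ambient →L[ℝ] ℝ :=
  μ • metricCLM - (k + μ) • (metricCLM vertical).smulRight (metricCLM vertical)

theorem comparisonForm_apply (μ k : ℝ) (v w : Ambient) :
    comparisonForm μ k v w = μ * metric v w - (k + μ) * (v 3 * w 3) := by
  simp [comparisonForm, metricCLM_apply, metric_comm vertical, metric_vertical]

theorem comparisonForm_comm (μ k : ℝ) (v w : Ambient) :
    comparisonForm μ k v w = comparisonForm μ k w v := by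
  rw [comparisonForm_apply, comparisonForm_apply, metric_comm, mul_comm (v 3)]

theorem comparisonForm_incl_self (μ k : ℝ) (p : HyperbolicPlane × ℝ) :
    comparisonForm μ k (incl p) (incl p) = -μ - k * p.2 ^ 2 := by
  rw [comparisonForm_apply, metric_incl_self]
  simp only [incl, Matrix.cons_val]
  ring

theorem comparisonForm_incl (μ k : ℝ) (p : HyperbolicPlane × ℝ) (v : Ambient) :
    comparisonForm μ k (incl p) v = metric (μ • radial p - (k * p.2) • vertical) v := by
  rw [comparisonForm_apply, metric_sub_left, metric_smul_left, metric_smul_left,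
    metric_comm vertical, metric_vertical]
  simp only [metric, incl, radial, Matrix.cons_val_zero, Matrix.cons_val_one, Matrix.cons_val,
    zero_mul, add_zero]
  ring

theorem comparison_le_of_barrier_le {c : HyperbolicPlane} {ε : ℝ} (hε : 0 ≤ ε) (μ : ℝ)
    {p q : HyperbolicPlane × ℝ} (h : barrier c ε q ≤ barrier c ε p) :
    comparisonForm μ (ε / √(1 + p.2 ^ 2)) (incl q) (incl q) / 2 -
        metricCLM (radial (c, 0)) (incl q) ≤
      comparisonForm μ (ε / √(1 + p.2 ^ 2)) (incl p) (incl p) / 2 -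
        metricCLM (radial (c, 0)) (incl p) := by
  have hconcave : ε * (√(1 + q.2 ^ 2) - √(1 + p.2 ^ 2)) ≤
      ε * ((1 + q.2 ^ 2 - (1 + p.2 ^ 2)) / (2 * √(1 + p.2 ^ 2))) :=
    mul_le_mul_of_nonneg_left (sqrt_sub_sqrt_le (by positivity) (by positivity)) hε
  have hslope : ε * ((1 + q.2 ^ 2 - (1 + p.2 ^ 2)) / (2 * √(1 + p.2 ^ 2))) =
      ε / √(1 + p.2 ^ 2) * q.2 ^ 2 / 2 - ε / √(1 + p.2 ^ 2) * p.2 ^ 2 / 2 := by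
    ring
  simp only [comparisonForm_incl_self, metricCLM_apply, metric_radial_incl]
  rw [barrier, barrier] at h
  linarith

/-- The gradient at `p`, within `ℍ² × ℝ`, of the function `-⟨c, x⟩ - k z² / 2`. -/
def comparisonGrad (c : HyperbolicPlane) (k : ℝ) (p : HyperbolicPlane × ℝ) : Ambient :=
  (-minkowski c.1 p.1.1) • radial p - (k * p.2) • vertical - radial (c, 0)

theorem metric_comparisonGrad_radial (c : HyperbolicPlane) (k : ℝ) (p : HyperbolicPlane × ℝ) :
    metric (comparisonGrad c k p) (radial p) = 0 := by
  have hp := p.1.2.1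
  rw [comparisonGrad, metric_sub_left, metric_sub_left, metric_smul_left, metric_smul_left,
    metric_radial_radial, metric_radial_radial, metric_comm vertical, metric_vertical, hp]
  simp [radial]

theorem comparisonGrad_apply_three (c : HyperbolicPlane) (k : ℝ) (p : HyperbolicPlane × ℝ) :
    comparisonGrad c k p 3 = -(k * p.2) := by
  simp [comparisonGrad, radial, vertical]

end Barrier

section Surface

variable {M : Type*} [TopologicalSpace M] [ChartedSpace Plane M]

/-- `n` is a unit normal at `p` to the surface `ψ` in `ℍ² × ℝ`; no continuous choice along `ψ`, and
hence no orientation, is involved. -/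
structure IsUnitNormalAt (ψ : M → HyperbolicPlane × ℝ) (p : M) (n : Ambient) : Prop where
  tangent : metric n (radial (ψ p)) = 0
  unit : metric n n = 1
  normal : ∀ v : TangentSpace 𝓘(ℝ, Plane) p,
    metric n (mfderiv 𝓘(ℝ, Plane) 𝓘(ℝ, Ambient) (fun q => incl (ψ q)) p v) = 0

theorem IsUnitNormal.isUnitNormalAt {ψ : M → HyperbolicPlane × ℝ} {η : M → Ambient}
    (hη : IsUnitNormal ψ η) (p : M) : IsUnitNormalAt ψ p (η p) :=
  ⟨hη.tangent p, hη.unit p, hη.normal p⟩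

/-- The differential of `ψ` at `p`, read in the chart at `p`. -/
def tangentMap (ψ : M → HyperbolicPlane × ℝ) (p : M) : Plane →L[ℝ] Ambient :=
  fderiv ℝ (localParam ψ p) (extChartAt 𝓘(ℝ, Plane) p p)

/-- The flat second derivative of `ψ` at `p`, read in the chart at `p`. -/
def hessianMap (ψ : M → HyperbolicPlane × ℝ) (p : M) : Plane →L[ℝ] Plane →L[ℝ] Ambient :=
  fderiv ℝ (fderiv ℝ (localParam ψ p)) (extChartAt 𝓘(ℝ, Plane) p p)

theorem localParam_extChartAt_self (ψ : M → HyperbolicPlane × ℝ) (p : M) :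
    localParam ψ p (extChartAt 𝓘(ℝ, Plane) p p) = incl (ψ p) := by
  rw [localParam, extChartAt_to_inv]

namespace IsImmersedSurface

variable {ψ : M → HyperbolicPlane × ℝ}

theorem contDiffAt_localParam (hψ : IsImmersedSurface ψ) (p : M) :
    ContDiffAt ℝ 2 (localParam ψ p) (extChartAt 𝓘(ℝ, Plane) p p) := by
  have hsmooth := (contMDiffAt_iff.1 (hψ.smooth p)).2
  rw [modelWithCornersSelf_coe, Set.range_id, contDiffWithinAt_univ] at hsmooth
  exact hsmooth.of_le (WithTop.coe_le_coe.2 le_top)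

theorem mfderiv_eq_tangentMap (hψ : IsImmersedSurface ψ) (p : M) :
    mfderiv 𝓘(ℝ, Plane) 𝓘(ℝ, Ambient) (fun q => incl (ψ q)) p = tangentMap ψ p := by
  rw [((hψ.smooth p).mdifferentiableAt (by simp)).mfderiv, modelWithCornersSelf_coe, Set.range_id,
    fderivWithin_univ]
  rfl

theorem tangentMap_injective (hψ : IsImmersedSurface ψ) (p : M) :
    Function.Injective (tangentMap ψ p) := by
  have hinjective := hψ.injective_mfderiv p
  rwa [hψ.mfderiv_eq_tangentMap p] at hinjective

theorem metric_unitNormal_tangentMap (hψ : IsImmersedSurface ψ) {p : M} {n : Ambient}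
    (hn : IsUnitNormalAt ψ p n) (w : Plane) : metric n (tangentMap ψ p w) = 0 := by
  rw [← hψ.mfderiv_eq_tangentMap p]
  exact hn.normal w

theorem secondOrder_of_isLocalMax_comparison (hψ : IsImmersedSurface ψ) {p : M} {μ k : ℝ}
    {a : Ambient} (hmax : IsLocalMax (fun q => comparisonForm μ k (incl (ψ q)) (incl (ψ q)) / 2 -
      metricCLM a (incl (ψ q))) p) (w : Plane) :
    metric (μ • radial (ψ p) - (k * (ψ p).2) • vertical - a) (tangentMap ψ p w) = 0 ∧
      μ * metric (tangentMap ψ p w) (tangentMap ψ p w) - (k + μ) * tangentMap ψ p w 3 ^ 2 +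
        metric (μ • radial (ψ p) - (k * (ψ p).2) • vertical - a) (hessianMap ψ p w w) ≤ 0 := by
  have hchart : Tendsto (extChartAt 𝓘(ℝ, Plane) p).symm
      (𝓝 (extChartAt 𝓘(ℝ, Plane) p p)) (𝓝 p) := by
    simpa using (continuousAt_extChartAt_symm (I := 𝓘(ℝ, Plane)) p).tendsto
  have hmax_chart : IsLocalMax (fun y => comparisonForm μ k (localParam ψ p y)
      (localParam ψ p y) / 2 - metricCLM a (localParam ψ p y)) (extChartAt 𝓘(ℝ, Plane) p p) := by
    filter_upwards [hchart.eventually hmax] with y hy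
    rwa [localParam_extChartAt_self]
  have hgrad (v : Ambient) : (comparisonForm μ k (incl (ψ p)) - metricCLM a) v =
      metric (μ • radial (ψ p) - (k * (ψ p).2) • vertical - a) v := by
    rw [sub_apply, comparisonForm_incl, metricCLM_apply, ← metric_sub_left]
  have hconditions := secondOrder_of_isLocalMax_quadratic_comp (comparisonForm_comm μ k)
    (hψ.contDiffAt_localParam p) hmax_chart w
  rwa [localParam_extChartAt_self, hgrad, hgrad, comparisonForm_apply, ← sq] at hconditions

theorem metric_tangentMap_radial (hψ : IsImmersedSurface ψ) (p : M) (w : Plane) :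
    metric (tangentMap ψ p w) (radial (ψ p)) = 0 := by
  have hconst : IsLocalMax (fun q => comparisonForm 1 0 (incl (ψ q)) (incl (ψ q)) / 2 -
      metricCLM 0 (incl (ψ q))) p :=
    .of_forall fun q => by simp [comparisonForm_incl_self]
  simpa [metric_comm] using (hψ.secondOrder_of_isLocalMax_comparison hconst w).1

theorem metric_tangentMap_self_pos (hψ : IsImmersedSurface ψ) (p : M) {w : Plane} (hw : w ≠ 0) :
    0 < metric (tangentMap ψ p w) (tangentMap ψ p w) :=
  metric_self_pos (hψ.metric_tangentMap_radial p w)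
    ((map_ne_zero_iff _ (hψ.tangentMap_injective p)).2 hw)

theorem secondForm_apply (hψ : IsImmersedSurface ψ) (η : M → Ambient) (p : M) (i j : Fin 2) :
    secondForm ψ η p i j = metric (hessianMap ψ p (EuclideanSpace.single i 1)
      (EuclideanSpace.single j 1)) (η p) := by
  have hderiv : HasFDerivAt (fderiv ℝ (localParam ψ p)) (hessianMap ψ p)
      (extChartAt 𝓘(ℝ, Plane) p p) :=
    (((hψ.contDiffAt_localParam p).fderiv_right (m := 1) (by norm_num)).differentiableAt
      (by simp)).hasFDerivAt
  have hpartial := (hderiv.clm_apply (hasFDerivAt_const (EuclideanSpace.single j 1) _)).fderiv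
  have hpartial_apply := DFunLike.congr_fun hpartial (EuclideanSpace.single i 1)
  simp only [ContinuousLinearMap.comp_zero, zero_add, ContinuousLinearMap.flip_apply]
    at hpartial_apply
  rw [← hpartial_apply]
  rfl

theorem exists_orthonormal_sum_hessianMap (hψ : IsImmersedSurface ψ) (p : M) :
    ∃ w : Fin 2 → Plane,
      (∀ i j, metric (tangentMap ψ p (w i)) (tangentMap ψ p (w j)) = if i = j then 1 else 0) ∧
      ∀ η : M → Ambient,
        ∑ i, metric (η p) (hessianMap ψ p (w i) (w i)) = 2 * meanCurvature ψ η p := by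
  set b : Basis (Fin 2) ℝ Plane := (EuclideanSpace.basisFun (Fin 2) ℝ).toBasis with hb
  set g : LinearMap.BilinForm ℝ Plane :=
    metricCLM.toBilinForm.comp (tangentMap ψ p) (tangentMap ψ p) with hg
  have hg_symm : g.IsSymm := ⟨fun v w => metric_comm _ _⟩
  obtain ⟨w, hw, htrace⟩ := exists_orthonormal_trace_inv_toMatrix_mul b hg_symm
    fun v hv => hψ.metric_tangentMap_self_pos p hv
  refine ⟨w, hw, fun η => ?_⟩
  set h : LinearMap.BilinForm ℝ Plane :=
    (hessianMap ψ p).toLinearMap₁₂.compr₂ (metricCLM (η p)) with hh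
  have hfirst : firstForm ψ p = g.toMatrix b := by
    ext i j
    simp only [hg, hb, LinearMap.BilinForm.toMatrix_apply, OrthonormalBasis.coe_toBasis,
      EuclideanSpace.basisFun_apply, LinearMap.BilinForm.comp_apply]
    rfl
  have hsecond : secondForm ψ η p = h.toMatrix b := by
    ext i j
    rw [hψ.secondForm_apply, metric_comm]
    simp [hh, hb, LinearMap.BilinForm.toMatrix_apply, metricCLM_apply]
  rw [meanCurvature, hfirst, hsecond, htrace, mul_div_cancel₀ _ two_ne_zero]
  rfl

theorem secondOrder_of_isLocalMax_barrier (hψ : IsImmersedSurface ψ) {p : M} {c : HyperbolicPlane}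
    {ε : ℝ} (hε : 0 ≤ ε) (hmax : IsLocalMax (barrier c ε ∘ ψ) p) (w : Plane) :
    metric (comparisonGrad c (ε / √(1 + (ψ p).2 ^ 2)) (ψ p)) (tangentMap ψ p w) = 0 ∧
      -minkowski c.1 (ψ p).1.1 * metric (tangentMap ψ p w) (tangentMap ψ p w) -
        (ε / √(1 + (ψ p).2 ^ 2) + -minkowski c.1 (ψ p).1.1) * tangentMap ψ p w 3 ^ 2 +
        metric (comparisonGrad c (ε / √(1 + (ψ p).2 ^ 2)) (ψ p)) (hessianMap ψ p w w) ≤ 0 :=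
  hψ.secondOrder_of_isLocalMax_comparison
    (hmax.mono fun _ hq => comparison_le_of_barrier_le hε (-minkowski c.1 (ψ p).1.1) hq) w

/-- Sums the second order condition over an orthonormal basis of the tangent plane, in which the
vertical components have square sum at most `1`. -/
theorem traced_secondOrder_of_isLocalMax_barrier (hψ : IsImmersedSurface ψ) {p : M}
    {η : M → Ambient} (hη : IsUnitNormalAt ψ p (η p)) {c : HyperbolicPlane}
    {ε : ℝ} (hε : 0 ≤ ε) (hmax : IsLocalMax (barrier c ε ∘ ψ) p) {k : ℝ}
    (hk : k = ε / √(1 + (ψ p).2 ^ 2)) :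
    metric (comparisonGrad c k (ψ p)) (η p) * metric (η p) vertical = -(k * (ψ p).2) ∧
      -minkowski c.1 (ψ p).1.1 - k +
        2 * (metric (comparisonGrad c k (ψ p)) (η p) * meanCurvature ψ η p) ≤ 0 := by
  obtain ⟨w, hw, hcurvature⟩ := hψ.exists_orthonormal_sum_hessianMap p
  have hconditions := hψ.secondOrder_of_isLocalMax_barrier hε hmax
  have htangent := fun i => hψ.metric_tangentMap_radial p (w i)
  have hk₀ : 0 ≤ k := hk ▸ by positivity
  rw [← hk] at hconditions
  set G := comparisonGrad c k (ψ p)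
  have hG_normal : G = metric G (η p) • η p :=
    eq_metric_smul_normal hw htangent hη.unit hη.tangent
      (fun i => hψ.metric_unitNormal_tangentMap hη (w i))
      (metric_comparisonGrad_radial c k (ψ p)) fun i => (hconditions (w i)).1
  have hG_metric (v : Ambient) : metric G v = metric G (η p) * metric (η p) v := by
    rw [← metric_smul_left, ← hG_normal]
  refine ⟨by rw [← hG_metric, metric_vertical, comparisonGrad_apply_three], ?_⟩
  have htilt : ∑ i, tangentMap ψ p (w i) 3 ^ 2 ≤ 1 := by
    have hbessel := sum_sq_metric_le hw htangent (v := vertical)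
      (by simp [metric, vertical, radial])
    have hunit : vertical 3 = 1 := by simp [vertical]
    simpa only [metric_comm vertical, metric_vertical, hunit] using hbessel
  have hsum := Finset.sum_nonpos fun i (_ : i ∈ Finset.univ) => (hconditions (w i)).2
  simp only [hG_metric (hessianMap _ _ _ _), hw, if_true, Finset.sum_add_distrib,
    Finset.sum_sub_distrib, ← Finset.mul_sum, hcurvature, Fin.sum_univ_two] at hsum htilt
  have hslack : 0 ≤ (k + -minkowski c.1 (ψ p).1.1) * (1 - (tangentMap ψ p (w 0) 3 ^ 2 +
      tangentMap ψ p (w 1) 3 ^ 2)) :=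
    mul_nonneg (by linarith [one_le_neg_minkowski c (ψ p).1]) (sub_nonneg.2 htilt)
  linarith

theorem one_le_of_isLocalMax_barrier (hψ : IsImmersedSurface ψ) {p : M} {η : M → Ambient}
    (hη : IsUnitNormalAt ψ p (η p)) {Λ : ℝ}
    (hH : |meanCurvature ψ η p| ≤ Λ * |metric (η p) vertical|) {c : HyperbolicPlane}
    {ε : ℝ} (hε : 0 ≤ ε) (hmax : IsLocalMax (barrier c ε ∘ ψ) p) :
    1 ≤ ε * (1 + 2 * |Λ|) := by
  obtain ⟨k, hk⟩ : ∃ k, k = ε / √(1 + (ψ p).2 ^ 2) := ⟨_, rfl⟩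
  obtain ⟨hangle, hsum⟩ := hψ.traced_secondOrder_of_isLocalMax_barrier hη hε hmax hk
  set g := metric (comparisonGrad c k (ψ p)) (η p)
  have hk_le : k ≤ ε := hk ▸ div_le_self hε (Real.one_le_sqrt.2 (by linarith [sq_nonneg (ψ p).2]))
  have hk₀ : 0 ≤ k := hk ▸ by positivity
  have hkz₀ : 0 ≤ k * |(ψ p).2| := mul_nonneg hk₀ (abs_nonneg _)
  have hkz : k * |(ψ p).2| ≤ ε := by
    rw [hk, div_mul_eq_mul_div, mul_div_assoc]
    exact mul_le_of_le_one_right hε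
      (div_le_one_of_le₀ (Real.abs_le_sqrt (by linarith)) (by positivity))
  have hdrift : |g * meanCurvature ψ η p| ≤ |Λ| * ε :=
    calc |g * meanCurvature ψ η p| ≤ |g| * (Λ * |metric (η p) vertical|) := by
          rw [abs_mul]; gcongr
      _ = Λ * (k * |(ψ p).2|) := by
        rw [mul_left_comm, ← abs_mul, hangle, abs_neg, abs_mul, abs_of_nonneg hk₀]
      _ ≤ |Λ| * (k * |(ψ p).2|) := mul_le_mul_of_nonneg_right (le_abs_self Λ) hkz₀
      _ ≤ |Λ| * ε := mul_le_mul_of_nonneg_left hkz (abs_nonneg Λ)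
  linarith [(abs_le.1 hdrift).1, one_le_neg_minkowski c (ψ p).1]

end IsImmersedSurface

end Surface

end HypProd

end

theorem mainTheorem9_general {M : Type*} [TopologicalSpace M] [Nonempty M]
    [ChartedSpace HypProd.Plane M] {ψ : M → HypProd.HyperbolicPlane × ℝ}
    (hψ : HypProd.IsImmersedSurface ψ) {η : M → HypProd.Ambient}
    (hη : ∀ p, HypProd.IsUnitNormalAt ψ p (η p)) {Λ : ℝ}
    (hH : ∀ p, |HypProd.meanCurvature ψ η p| ≤ Λ * |HypProd.metric (η p) HypProd.vertical|)
    (hproper : IsProperMap ψ) :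
    ¬ ∃ (c : HypProd.HyperbolicPlane) (R : ℝ), Set.range ψ ⊆ HypProd.solidCylinder c R := by
  rintro ⟨c, R, hcylinder⟩
  have hε : 0 < 1 / (2 * (1 + 2 * |Λ|)) := by positivity
  obtain ⟨p, hmax⟩ := HypProd.exists_forall_barrier_le hproper hcylinder hε
  have hone := hψ.one_le_of_isLocalMax_barrier (hη p) (hH p) hε.le (.of_forall hmax)
  have hhalf : 1 / (2 * (1 + 2 * |Λ|)) * (1 + 2 * |Λ|) = 1 / 2 := by field_simp
  linarith

theorem mainTheorem9 {M : Type*} [TopologicalSpace M] [T2Space M] [SecondCountableTopology M]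
    [Nonempty M] [ChartedSpace HypProd.Plane M] [IsManifold 𝓘(ℝ, HypProd.Plane) ∞ M]
    (ψ : M → HypProd.HyperbolicPlane × ℝ)
    (hsol : HypProd.IsTranslatingSoliton ψ) (hproper : IsProperMap ψ) :
    ¬ ∃ (c : HypProd.HyperbolicPlane) (R : ℝ), Set.range ψ ⊆ HypProd.solidCylinder c R := by
  obtain ⟨η, hη, hH⟩ := hsol.exists_normal
  exact mainTheorem9_general (Λ := 1) hsol.immersed hη.isUnitNormalAt (fun p => by simp [hH p])
    hproper
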